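/- Let $k$ be a field and let $G$ be a finite simple graph. Let $I(G)=(x_ux_v : \{u,v\}\in E(G))$ be its edge ideal in the polynomial ring $R=k[x_v : v\in V(G)]$. A \emph{bow} in $G$ is a subgraph that is the union of two odd cycles $C,C'$ of $G$ with $d_G(C,C')\ge 2$, where $d_G(C,C')$ is the minimum distance in $G$ between a vertex of $C$ and a vertex of $C'$ (and is $\infty$ if no path of $G$ joins them). For a subgraph $B$ put $m_B=\prod_{v\in V(B)}x_v$. For an ideal $J\subseteq R$, its integral closure $\overline J$ is the set of all $r\in R$ that satisfy an equation $r^d+a_1r^{d-1}+\dots+a_d=0$ with $d\ge 1$ and $a_i\in J^i$ for $1\le i\le d$. Suppose that $G$ is odd bicyclic, that is, $G$ has exactly two odd cycles (as subgraphs, not necessarily induced), of sizes $2m+1$ and $2n+1$, and suppose that $G$ has a unique bow $B$ (the union of these two cycles). Then, for every integer $s\ge 0$, $$\overline{I(G)^s}=\begin{cases} I(G)^s & \text{if } s\le m+n,\\ I(G)^s+m_B\,I(G)^{s-m-n-1} & \text{if } s\ge m+n+1.\end{cases}$$ -/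

import Mathlib

noncomputable section

namespace BowGraph

variable {V : Type*} {G : SimpleGraph V}

/-- A subgraph `C` of `G` is a cycle of size `n`: its vertices and edges are those traversed by a
closed walk of length `n` that repeats no edge and no vertex (except the end points). -/
def IsCycleOfSize (C : G.Subgraph) (n : ℕ) : Prop :=
  ∃ (u : V) (p : G.Walk u u), p.IsCycle ∧ p.length = n ∧ p.toSubgraph = C

/-- A subgraph of `G` that is an odd cycle. -/
def IsOddCycle (C : G.Subgraph) : Prop :=
  ∃ n : ℕ, Odd n ∧ IsCycleOfSize C n

/-- `G` is odd bicyclic: among its subgraphs there are exactly two odd cycles. -/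
def IsOddBicyclic (G : SimpleGraph V) : Prop :=
  {C : G.Subgraph | IsOddCycle C}.encard = 2

/-- The distance in `G` between two subgraphs (`⊤` if no path of `G` joins them). -/
def subgraphDist (H H' : G.Subgraph) : ℕ∞ :=
  ⨅ u ∈ H.verts, ⨅ v ∈ H'.verts, G.edist u v

/-- A subgraph `B` of `G` is a bow: it is the union of two odd cycles of `G` whose distance in `G`
is at least two. -/
def IsBow (B : G.Subgraph) : Prop :=
  ∃ C C' : G.Subgraph, IsOddCycle C ∧ IsOddCycle C' ∧ 2 ≤ subgraphDist C C' ∧ B = C ⊔ C'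

/-- The edge ideal `I(G)` in the polynomial ring over `k` with one variable for each vertex. -/
def edgeIdeal (k : Type*) [Field k] (G : SimpleGraph V) : Ideal (MvPolynomial V k) :=
  Ideal.span {f | ∃ u v : V, G.Adj u v ∧ f = MvPolynomial.X u * MvPolynomial.X v}

open Classical in
/-- The monomial `m_H`, the product of the variables of the vertices of `H`. -/
def vertexMonomial (k : Type*) [Field k] [Fintype V] (H : G.Subgraph) : MvPolynomial V k :=
  ∏ v ∈ Finset.univ.filter (fun v => v ∈ H.verts), MvPolynomial.X v

/-- `r` is integral over the ideal `I`: it satisfies an equation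
`r ^ d + a₁ * r ^ (d - 1) + ⋯ + a_d = 0` with `d ≥ 1` and `a_i ∈ I ^ i`. -/
def IsIntegralOverIdeal {R : Type*} [CommRing R] (I : Ideal R) (r : R) : Prop :=
  ∃ d : ℕ, 1 ≤ d ∧ ∃ a : ℕ → R, (∀ i ∈ Finset.Icc 1 d, a i ∈ I ^ i) ∧
    r ^ d + ∑ i ∈ Finset.Icc 1 d, a i * r ^ (d - i) = 0

/-- The integral closure of an ideal `I`: the set of all elements that are integral over `I`. -/
def idealIntegralClosure {R : Type*} [CommRing R] (I : Ideal R) : Set R :=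
  {r | IsIntegralOverIdeal I r}

end BowGraph

end

namespace BowGraph

/-! A weight that is at least 2 on every edge is at least 2s on each monomial x^a of an element
integral over I(G)^s (`le_weight_of_isIntegralOverIdeal`). By Hall's theorem these inequalities
yield 2s edges, with repetition, whose product divides x^(2a) (`exists_edges_of_le_weight`).

It remains to halve this multiset of edges (`exists_decomposition`). A repeated edge, an edge at a
leaf and an even cycle can each be replaced by edges fitting into a, with no loss beyond the factor
2. Only odd cycles resist, and two copies of one odd cycle are equivalent to its edge set, so at
most one copy of each cycle survives. If at most one survives, parity lets a near-perfect matching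
of it make up the count. If both survive, x^a is divisible by m_B times s-m-n-1 edges, or, for s ≤
m+n, the two matchings alone suffice.

Conversely, the square of m_B is the product of all edges of the two cycles, so it lies in
I(G)^(2(m+n+1)), and a quadratic equation gives integrality. -/

/-! ### Weights as valuations on integral elements -/

/-- An element whose integral equation over a chain of powers of a prime has coefficients divisible
by those powers is itself divisible. -/
theorem prime_pow_dvd_of_integral_equation {A : Type*} [CommRing A] [IsDomain A] {π : A}
    (hπ : Prime π) {f : A} {N d : ℕ} (hd : 1 ≤ d) {a : ℕ → A}
    (ha : ∀ i ∈ Finset.Icc 1 d, π ^ (N * i) ∣ a i)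
    (h : f ^ d + ∑ i ∈ Finset.Icc 1 d, a i * f ^ (d - i) = 0) : π ^ N ∣ f := by
  suffices H : ∀ c ≤ N, π ^ c ∣ f from H N le_rfl
  intro c
  induction c with
  | zero => simp
  | succ c ih =>
    intro hc
    obtain ⟨g, hg⟩ := ih (by omega)
    -- The i-th term is divisible by π to the power N i + c (d - i) ≥ c d + i, and i ≥ 1.
    have h1 : π ^ (c * d + 1) ∣ f ^ d := by
      rw [eq_neg_of_add_eq_zero_left h, dvd_neg]
      refine Finset.dvd_sum fun i hi ↦ ?_
      have hi' := Finset.mem_Icc.1 hi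
      have h2 : π ^ (c * (d - i)) ∣ f ^ (d - i) := by
        rw [hg, mul_pow, ← pow_mul]; exact dvd_mul_right _ _
      refine dvd_trans (pow_dvd_pow π ?_) (pow_add π (N * i) _ ▸ mul_dvd_mul (ha i hi) h2)
      obtain ⟨j, rfl⟩ := Nat.exists_eq_add_of_le hi'.2
      have : (c + 1) * i ≤ N * i := Nat.mul_le_mul_right i hc
      rw [Nat.add_sub_cancel_left]
      nlinarith
    rw [hg, mul_pow, ← pow_mul, pow_succ] at h1
    have h3 := (mul_dvd_mul_iff_left (pow_ne_zero _ hπ.ne_zero)).1 h1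
    rw [hg, pow_succ]
    exact mul_dvd_mul_left _ (hπ.dvd_of_dvd_pow h3)

/-- The substitution `x_v ↦ x_v * T ^ (w v)`. -/
noncomputable def weightHom (k : Type*) [Field k] {V : Type*} (w : V → ℕ) :
    MvPolynomial V k →+* Polynomial (MvPolynomial V k) :=
  MvPolynomial.eval₂Hom (Polynomial.C.comp MvPolynomial.C)
    fun v ↦ Polynomial.C (MvPolynomial.X v) * Polynomial.X ^ w v

theorem weightHom_X {k : Type*} [Field k] {V : Type*} (w : V → ℕ) (v : V) :
    weightHom k w (MvPolynomial.X v) = Polynomial.C (MvPolynomial.X v) * Polynomial.X ^ w v := by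
  simp [weightHom]

theorem weightHom_monomial {k : Type*} [Field k] {V : Type*} (w : V → ℕ) (a : V →₀ ℕ) (c : k) :
    weightHom k w (MvPolynomial.monomial a c) =
      Polynomial.monomial (a.sum fun v n ↦ w v * n) (MvPolynomial.monomial a c) := by
  rw [weightHom, MvPolynomial.eval₂Hom_monomial, MvPolynomial.monomial_eq,
    ← Polynomial.C_mul_X_pow_eq_monomial]
  simp only [Finsupp.prod, Finsupp.sum, mul_pow, Finset.prod_mul_distrib, ← pow_mul,
    Finset.prod_pow_eq_pow_sum, map_mul, map_prod, map_pow, RingHom.comp_apply]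
  ring

/-- The coefficients of the powers of T keep the original monomials, so distinct monomials of f of
equal weight cannot cancel. -/
theorem le_weight_of_X_pow_dvd_weightHom {k : Type*} [Field k] {V : Type*} {w : V → ℕ}
    {f : MvPolynomial V k} {N : ℕ} (h : Polynomial.X ^ N ∣ weightHom k w f) {a : V →₀ ℕ}
    (ha : a ∈ f.support) : N ≤ a.sum fun v n ↦ w v * n := by
  by_contra! hlt
  have h0 := (Polynomial.X_pow_dvd_iff.1 h) _ hlt
  rw [f.as_sum, map_sum, Polynomial.finsetSum_coeff] at h0
  simp only [weightHom_monomial, Polynomial.coeff_monomial] at h0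
  have h1 := congrArg (MvPolynomial.coeff a) h0
  classical
  rw [MvPolynomial.coeff_sum, Finset.sum_eq_single a] at h1
  · simp at h1
    exact (MvPolynomial.mem_support_iff.1 ha) h1
  · intro b _ hb
    split_ifs
    · simp [MvPolynomial.coeff_monomial, hb]
    · simp
  · exact fun h ↦ absurd ha h

/-- A weight that is at least two on every edge is at least `2 * s` on every monomial of an element
that is integral over `I(G) ^ s`. -/
theorem le_weight_of_isIntegralOverIdeal {k : Type*} [Field k] {V : Type*} {G : SimpleGraph V}
    {s : ℕ} {f : MvPolynomial V k} (hf : IsIntegralOverIdeal (edgeIdeal k G ^ s) f) {w : V → ℕ}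
    (hw : ∀ u v, G.Adj u v → 2 ≤ w u + w v) {a : V →₀ ℕ} (ha : a ∈ f.support) :
    2 * s ≤ a.sum fun v n ↦ w v * n := by
  refine le_weight_of_X_pow_dvd_weightHom (k := k) ?_ ha
  obtain ⟨d, hd, c, hc, h⟩ := hf
  have hmap : (edgeIdeal k G).map (weightHom k w) ≤ Ideal.span {Polynomial.X ^ 2} := by
    rw [edgeIdeal, Ideal.map_span, Ideal.span_le]
    rintro _ ⟨_, ⟨u, v, huv, rfl⟩, rfl⟩
    rw [SetLike.mem_coe, Ideal.mem_span_singleton, map_mul, weightHom_X, weightHom_X]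
    refine (pow_dvd_pow _ (hw u v huv)).trans ⟨Polynomial.C (MvPolynomial.X u * MvPolynomial.X v), ?_⟩
    rw [pow_add, Polynomial.C_mul]; ring
  refine prime_pow_dvd_of_integral_equation (a := fun i ↦ weightHom k w (c i)) Polynomial.prime_X hd
    (fun i hi ↦ ?_) ?_
  · have h1 := Ideal.mem_map_of_mem (weightHom k w) (hc i hi)
    rw [← pow_mul, Ideal.map_pow] at h1
    have h2 := Ideal.pow_right_mono hmap _ h1
    rw [Ideal.span_singleton_pow, Ideal.mem_span_singleton, ← pow_mul] at h2
    rwa [mul_assoc]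
  · simpa using congrArg (weightHom k w) h

/-! ### Exponents of edge multisets and walks -/

/-- The exponent of the monomial attached to an edge. -/
noncomputable def edgeVec {V : Type*} : Sym2 V → (V →₀ ℕ) :=
  Sym2.lift ⟨fun u v ↦ Finsupp.single u 1 + Finsupp.single v 1, fun _ _ ↦ add_comm _ _⟩

@[simp] theorem edgeVec_mk {V : Type*} (u v : V) :
    edgeVec s(u, v) = Finsupp.single u 1 + Finsupp.single v 1 := rfl

/-- The exponent of the product of the monomials of a multiset of edges. -/
noncomputable def degVec {V : Type*} : Multiset (Sym2 V) →+ (V →₀ ℕ) :=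
  Multiset.sumAddMonoidHom.comp (Multiset.mapAddMonoidHom edgeVec)

@[simp] theorem degVec_cons {V : Type*} (e : Sym2 V) (F : Multiset (Sym2 V)) :
    degVec (e ::ₘ F) = edgeVec e + degVec F := by simp [degVec]

@[simp] theorem degVec_singleton {V : Type*} (e : Sym2 V) : degVec {e} = edgeVec e := by
  simp [degVec]

/-- The number of occurrences in a list, as an exponent. -/
noncomputable def listVec {V : Type*} (l : List V) : V →₀ ℕ :=
  (l.map fun v ↦ Finsupp.single v 1).sum

@[simp] theorem listVec_nil {V : Type*} : listVec ([] : List V) = 0 := rfl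

@[simp] theorem listVec_cons {V : Type*} (v : V) (l : List V) :
    listVec (v :: l) = Finsupp.single v 1 + listVec l := by simp [listVec]

theorem degree_listVec {V : Type*} (l : List V) : (listVec l).degree = l.length := by
  induction l with
  | nil => simp
  | cons u l ih => simp [ih, add_comm]

theorem listVec_apply {V : Type*} [DecidableEq V] (l : List V) (v : V) :
    listVec l v = l.count v := by
  induction l with
  | nil => simp
  | cons u l ih => simp [ih, List.count_cons, Finsupp.single_apply, add_comm]

variable {V : Type*} {G : SimpleGraph V}

/-- Each visit to a vertex uses two edges, except that each end of the walk lacks one. -/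
theorem degVec_edges {u v : V} (p : G.Walk u v) :
    degVec (p.edges : Multiset (Sym2 V)) + Finsupp.single u 1 + Finsupp.single v 1 =
      2 • listVec p.support := by
  induction p with
  | nil => simp [two_smul]
  | @cons u w v h p ih =>
    rw [SimpleGraph.Walk.edges_cons, SimpleGraph.Walk.support_cons, ← Multiset.cons_coe,
      degVec_cons, listVec_cons, smul_add, ← ih, edgeVec_mk]
    simp only [two_smul]; abel

theorem degVec_edges_closed {u : V} (p : G.Walk u u) :
    degVec (p.edges : Multiset (Sym2 V)) = 2 • listVec p.support.tail := by
  have h := degVec_edges p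
  rw [← SimpleGraph.Walk.cons_tail_support, listVec_cons, smul_add, two_smul _ (Finsupp.single u 1),
    add_assoc, add_comm] at h
  exact add_left_cancel h

/-- A walk of even length is matched perfectly by every other edge, apart from its origin. -/
theorem exists_matching_even (k : ℕ) {u v : V} (p : G.Walk u v) (hp : p.length = 2 * k) :
    ∃ E : Multiset (Sym2 V), (∀ e ∈ E, e ∈ G.edgeSet) ∧ E.card = k ∧
      degVec E = listVec p.support.tail := by
  induction k generalizing u v with
  | zero =>
    refine ⟨0, by simp, by simp, ?_⟩
    cases p with
    | nil => simp
    | cons h p => simp at hp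
  | succ k ih =>
    cases p with
    | nil => simp at hp
    | @cons _ w _ h p =>
      cases p with
      | nil => simp at hp; omega
      | @cons _ x _ h' p =>
        obtain ⟨E, hE, hk, hd⟩ := ih p (by simp at hp; omega)
        refine ⟨s(w, x) ::ₘ E, ?_, by simp [hk], ?_⟩
        · intro e he
          rcases Multiset.mem_cons.1 he with rfl | he
          · exact h'
          · exact hE e he
        · simp only [degVec_cons, edgeVec_mk, hd, SimpleGraph.Walk.support_cons, List.tail_cons]
          rw [← SimpleGraph.Walk.cons_tail_support p, listVec_cons, listVec_cons, List.tail_cons,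
            add_assoc]

/-- Dropping the first edge leaves an even walk. On an odd cycle this gives a matching that misses
one vertex. -/
theorem exists_matching_odd (k : ℕ) {u v : V} (p : G.Walk u v) (hp : p.length = 2 * k + 1) :
    ∃ E : Multiset (Sym2 V), (∀ e ∈ E, e ∈ G.edgeSet) ∧ E.card = k ∧
      degVec E ≤ listVec p.support.tail := by
  cases p with
  | nil => simp at hp
  | @cons _ w _ h p =>
    obtain ⟨E, hE, hk, hd⟩ := exists_matching_even k p (by simpa using hp)
    refine ⟨E, hE, hk, ?_⟩
    rw [hd, SimpleGraph.Walk.support_cons, List.tail_cons, ← SimpleGraph.Walk.cons_tail_support p,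
      listVec_cons, List.tail_cons]
    exact le_add_self

/-! ### Duality: from weights to edges -/

/-- An acyclic graph with an edge has a vertex with exactly one neighbour. -/
theorem exists_leaf [Finite V] {H : SimpleGraph V} (hH : H.IsAcyclic) {x y : V} (hxy : H.Adj x y) :
    ∃ v u, H.Adj v u ∧ ∀ w, H.Adj v w → w = u := by
  classical
  have := Fintype.ofFinite V
  -- A longest path starts at a leaf: another neighbour of its origin would extend the path or close
  -- a cycle.
  let P : ℕ → Prop := fun n ↦ ∃ (a b : V) (p : H.Walk a b), p.IsPath ∧ p.length = n
  have hP1 : P 1 := ⟨x, y, hxy.toWalk, by simp [hxy.ne], rfl⟩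
  have hc : 1 ≤ Fintype.card V := Fintype.card_pos_iff.2 ⟨x⟩
  obtain ⟨a, b, p, hp, hl⟩ := Nat.findGreatest_spec (P := P) hc hP1
  have h1 : 1 ≤ p.length := hl ▸ Nat.le_findGreatest hc hP1
  refine ⟨a, p.snd, p.adj_snd ?_, fun w hw ↦ ?_⟩
  · rw [SimpleGraph.Walk.not_nil_iff_lt_length]; exact h1
  · refine hH.eq_snd_of_adj_start hp hw ?_
    by_contra hmem
    have hq : (SimpleGraph.Walk.cons hw.symm p).IsPath := hp.cons hmem
    have h2 : p.length + 1 ≤ Nat.findGreatest P (Fintype.card V) :=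
      Nat.le_findGreatest (by simpa using hq.length_lt.le) ⟨w, b, _, hq, by simp⟩
    omega

theorem sum_comp_le_of_injective {α β M : Type*} [Fintype α] [Fintype β] [AddCommMonoid M]
    [PartialOrder M] [IsOrderedAddMonoid M] [CanonicallyOrderedAdd M] {f : α → β}
    (hf : Function.Injective f) (g : β → M) : ∑ x, g (f x) ≤ ∑ z, g z := by
  classical
  rw [← Finset.sum_image (f := g) (fun x _ y _ hxy ↦ hf hxy)]
  exact Finset.sum_le_sum_of_subset (Finset.subset_univ _)

/-- König's theorem in the bipartite double cover: if every integral weight that is at least two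
on every edge gives `a` a weight at least `N`, then `N` edges fit into `2 • a`. -/
theorem exists_edges_of_le_weight [Fintype V] {a : V →₀ ℕ} {N : ℕ}
    (h : ∀ w : V → ℕ, (∀ u v, G.Adj u v → 2 ≤ w u + w v) → N ≤ a.sum fun v n ↦ w v * n) :
    ∃ F : Multiset (Sym2 V), (∀ e ∈ F, e ∈ G.edgeSet) ∧ N ≤ F.card ∧ degVec F ≤ 2 • a := by
  classical
  have hsum (w : V → ℕ) : (a.sum fun v n ↦ w v * n) = ∑ v, w v * a v :=
    Finsupp.sum_fintype _ _ (by simp)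
  simp only [hsum] at h
  let L := Σ v : V, Fin (a v)
  have hL : Fintype.card L = ∑ v, a v := by simp [L]
  have hN : N ≤ Fintype.card L := by
    have := h (fun _ ↦ 1) (fun _ _ _ ↦ le_rfl)
    simpa [hL] using this
  obtain ⟨d, hd⟩ := Nat.exists_eq_add_of_le hN
  -- `L` holds `a v` copies of each vertex v. The d = |L| - N dummy vertices are joined to
  -- everything, so a matching saturating `L` uses at least N genuine edges.
  let r : L → L ⊕ Fin d → Prop := fun x ↦ Sum.elim (fun y ↦ G.Adj x.1 y.1) (fun _ ↦ True)
  have hall : ∀ S : Finset L, S.card ≤ (Finset.univ.filter fun z ↦ ∃ x ∈ S, r x z).card := by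
    intro S
    rcases S.eq_empty_or_nonempty with rfl | ⟨x₀, hx₀⟩
    · simp
    let A : Finset V := S.image Sigma.fst
    let T : Finset V := Finset.univ.filter fun v ↦ ∃ u ∈ A, G.Adj u v
    have h1 : S.card ≤ ∑ v ∈ A, a v := by
      have hS : S ⊆ A.sigma fun _ ↦ Finset.univ := fun x hx ↦
        Finset.mem_sigma.2 ⟨Finset.mem_image_of_mem _ hx, Finset.mem_univ _⟩
      refine (Finset.card_le_card hS).trans (le_of_eq ?_)
      rw [Finset.card_sigma]
      exact Finset.sum_congr rfl fun v _ ↦ Finset.card_univ.trans (Fintype.card_fin (a v))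
    have h2 : ∑ v ∈ T, a v + d ≤ (Finset.univ.filter fun z ↦ ∃ x ∈ S, r x z).card := by
      have hT : (T.sigma fun v ↦ (Finset.univ : Finset (Fin (a v)))).disjSum
          (Finset.univ : Finset (Fin d)) ⊆ Finset.univ.filter fun z ↦ ∃ x ∈ S, r x z := by
        intro z hz
        rw [Finset.mem_filter]
        refine ⟨Finset.mem_univ _, ?_⟩
        rcases Finset.mem_disjSum.1 hz with ⟨y, hy, rfl⟩ | ⟨y, hy, rfl⟩
        · obtain ⟨u, hu, huv⟩ := (Finset.mem_filter.1 (Finset.mem_sigma.1 hy).1).2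
          obtain ⟨x, hx, rfl⟩ := Finset.mem_image.1 hu
          exact ⟨x, hx, huv⟩
        · exact ⟨x₀, hx₀, trivial⟩
      have := Finset.card_le_card hT
      rwa [Finset.card_disjSum, Finset.card_sigma, Finset.card_univ, Fintype.card_fin,
        Finset.sum_congr rfl (fun v _ ↦ (Finset.card_univ.trans (Fintype.card_fin (a v))))] at this
    -- Hall's condition comes from testing the hypothesis on the complement of A plus the
    -- neighbourhood T of A: a vertex cover of the double cover, folded onto V.
    have h3 := h (fun v ↦ (if v ∈ A then 0 else 1) + if v ∈ T then 1 else 0) (by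
      intro u v huv
      have h5 : u ∈ A → v ∈ T := fun hu ↦ Finset.mem_filter.2 ⟨Finset.mem_univ _, u, hu, huv⟩
      have h6 : v ∈ A → u ∈ T := fun hv ↦
        Finset.mem_filter.2 ⟨Finset.mem_univ _, v, hv, huv.symm⟩
      split_ifs <;> first | omega | tauto)
    have h4 : ∑ v, ((if v ∈ A then 0 else 1) + if v ∈ T then 1 else 0) * a v + ∑ v ∈ A, a v =
        ∑ v, a v + ∑ v ∈ T, a v := by
      rw [← Finset.univ_inter A, ← Finset.univ_inter T, ← Finset.sum_ite_mem, ← Finset.sum_ite_mem,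
        ← Finset.sum_add_distrib, ← Finset.sum_add_distrib]
      refine Finset.sum_congr rfl fun v _ ↦ ?_
      simp only [Finset.univ_inter]
      split_ifs <;> ring
    omega
  obtain ⟨f, hf, hr⟩ := (Fintype.all_card_le_filter_rel_iff_exists_injective r).1 hall
  let φ (x : L) : L ⊕ Fin d → Multiset (Sym2 V) := Sum.elim (fun y ↦ {s(x.1, y.1)}) fun _ ↦ 0
  let ψ : L ⊕ Fin d → V →₀ ℕ := Sum.elim (fun y ↦ Finsupp.single y.1 1) fun _ ↦ 0
  let χ : L ⊕ Fin d → ℕ := Sum.elim (fun _ ↦ 0) fun _ ↦ 1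
  have hsa : ∑ x : L, Finsupp.single x.1 1 = a := by
    rw [Fintype.sum_sigma]
    simp only [Finset.sum_const, Finset.card_univ, Fintype.card_fin]
    ext v
    simp
  refine ⟨∑ x, φ x (f x), fun e he ↦ ?_, ?_, ?_⟩
  · obtain ⟨x, -, hx⟩ := Multiset.mem_sum.1 he
    have hrx := hr x
    cases hfx : f x with
    | inl y =>
      rw [hfx] at hx hrx
      rw [Multiset.mem_singleton.1 hx]
      exact hrx
    | inr y => simp [hfx, φ] at hx
  · have h1 : ∑ x, (φ x (f x)).card + ∑ x, χ (f x) = Fintype.card L := by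
      rw [← Finset.sum_add_distrib, Fintype.card_eq_sum_ones]
      refine Finset.sum_congr rfl fun x _ ↦ ?_
      cases f x <;> simp [φ, χ]
    have h2 : ∑ x, χ (f x) ≤ d := (sum_comp_le_of_injective hf χ).trans (by simp [χ])
    rw [Multiset.card_sum]
    omega
  -- Left ends exhaust `a` exactly; right ends are distinct by injectivity and cost at most another
  -- `a`.
  · rw [map_sum, two_smul]
    calc ∑ x, degVec (φ x (f x)) ≤ ∑ x, (Finsupp.single x.1 1 + ψ (f x)) := by
          refine Finset.sum_le_sum fun x _ ↦ ?_
          cases f x <;> simp [φ, ψ]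
      _ ≤ a + a := by
          rw [Finset.sum_add_distrib, hsa]
          refine add_le_add_right ((sum_comp_le_of_injective hf ψ).trans ?_) a
          rw [Fintype.sum_sum_type]
          simp [ψ, hsa]

/-! ### Halving a multiset of edges -/

theorem exists_add_of_two_smul_add_le {x y a : V →₀ ℕ} (h : 2 • x + y ≤ 2 • a) :
    ∃ b, a = b + x ∧ y ≤ 2 • b := by
  have h' : ∀ v, 2 * x v + y v ≤ 2 * a v := by simpa using fun v ↦ h v
  refine ⟨a - x, ?_, fun v ↦ ?_⟩
  · ext v
    have := h' v
    simp; omega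
  · have := h' v
    simp; omega

/-- If all odd cycles of `G` have one of two exponents, then edges that fit into `2 • a` can be
traded for half as many edges that fit into `a` along with copies of the odd cycles. -/
theorem exists_decomposition [Finite V] {c₁ c₂ : V →₀ ℕ} {m n : ℕ}
    (hcyc : ∀ (u : V) (p : G.Walk u u), p.IsCycle → Odd p.length →
      (p.length = 2 * m + 1 ∧ listVec p.support.tail = c₁) ∨
      (p.length = 2 * n + 1 ∧ listVec p.support.tail = c₂))
    (F : Multiset (Sym2 V)) (hF : ∀ e ∈ F, e ∈ G.edgeSet) (a : V →₀ ℕ) (ha : degVec F ≤ 2 • a) :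
    ∃ (E : Multiset (Sym2 V)) (i j : ℕ), (∀ e ∈ E, e ∈ G.edgeSet) ∧
      degVec E + i • c₁ + j • c₂ ≤ a ∧
      F.card ≤ 2 * E.card + i * (2 * m + 1) + j * (2 * n + 1) := by
  classical
  induction hN : F.card using Nat.strong_induction_on generalizing F a with
  | _ N ih =>
  subst hN
  -- One induction step: F shrinks to F', the exponent b is left for it, and the removed edges are
  -- paid for by E₀ and the cycle copies.
  have step (E₀ : Multiset (Sym2 V)) (i₀ j₀ : ℕ) (F' : Multiset (Sym2 V)) (b : V →₀ ℕ)
      (hlt : F'.card < F.card) (hF' : F' ≤ F) (hE₀ : ∀ e ∈ E₀, e ∈ G.edgeSet)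
      (hb : degVec F' ≤ 2 • b) (hab : b + (degVec E₀ + i₀ • c₁ + j₀ • c₂) ≤ a)
      (hcard : F.card ≤ F'.card + (2 * E₀.card + i₀ * (2 * m + 1) + j₀ * (2 * n + 1))) :
      ∃ (E : Multiset (Sym2 V)) (i j : ℕ), (∀ e ∈ E, e ∈ G.edgeSet) ∧
        degVec E + i • c₁ + j • c₂ ≤ a ∧
        F.card ≤ 2 * E.card + i * (2 * m + 1) + j * (2 * n + 1) := by
    obtain ⟨E, i, j, hE, hd, hc⟩ :=
      ih _ hlt F' (fun e he ↦ hF e (Multiset.mem_of_le hF' he)) b hb rfl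
    refine ⟨E + E₀, i + i₀, j + j₀, fun e he ↦ ?_, ?_, ?_⟩
    · exact (Multiset.mem_add.1 he).elim (hE e) (hE₀ e)
    · refine le_trans (le_of_eq ?_) ((add_le_add_left hd _).trans hab)
      simp only [map_add, add_smul]
      abel
    · rw [Multiset.card_add]
      linarith
  by_cases hnd : F.Nodup
  swap
  · obtain ⟨e, he⟩ : ∃ e, 2 ≤ F.count e := by
      by_contra! hcon
      exact hnd (Multiset.nodup_iff_count_le_one.2 fun e ↦ Nat.le_of_lt_succ (hcon e))
    obtain ⟨F', rfl⟩ := Multiset.le_iff_exists_add.1 (Multiset.le_count_iff_replicate_le.1 he)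
    rw [map_add, show Multiset.replicate 2 e = 2 • {e} from (Multiset.nsmul_singleton e 2).symm,
      map_nsmul, degVec_singleton] at ha
    obtain ⟨b, rfl, hb⟩ := exists_add_of_two_smul_add_le ha
    refine step {e} 0 0 F' b (by simp) (Multiset.le_add_left _ _) ?_ hb (by simp) ?_
    · simpa using hF e (by simp)
    · simp
  rcases F.empty_or_exists_mem with rfl | ⟨e₀, he₀⟩
  · exact ⟨0, 0, 0, by simp, by simp, by simp⟩
  let H := SimpleGraph.fromEdgeSet {e | e ∈ F}
  have hadj (u v : V) : H.Adj u v ↔ s(u, v) ∈ F := by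
    rw [SimpleGraph.fromEdgeSet_adj]
    exact ⟨fun h ↦ h.1, fun h ↦ ⟨h, G.ne_of_adj (hF _ h)⟩⟩
  by_cases hH : H.IsAcyclic
  · obtain ⟨x, y, hxy⟩ : ∃ x y, H.Adj x y := by
      induction e₀ with | _ x y => exact ⟨x, y, (hadj x y).2 he₀⟩
    obtain ⟨v, u, hvu, huniq⟩ := exists_leaf hH hxy
    have hne : v ≠ u := hvu.ne
    rw [hadj] at hvu
    obtain ⟨F', rfl⟩ := Multiset.exists_cons_of_mem hvu
    have hv : degVec F' v = 0 := by
      have hmem : ∀ e ∈ F', v ∉ e := by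
        rintro e he hve
        obtain ⟨w, rfl⟩ := Sym2.mem_iff_exists.1 hve
        have := huniq w ((hadj v w).2 (Multiset.mem_cons_of_mem he))
        subst this
        exact (Multiset.nodup_cons.1 hnd).1 he
      clear * - hmem
      induction F' using Multiset.induction with
      | empty => simp
      | cons e F ih =>
        rw [degVec_cons, Finsupp.add_apply, ih fun e he ↦ hmem e (Multiset.mem_cons_of_mem he)]
        have := hmem e (Multiset.mem_cons_self _ _)
        induction e with | _ x y =>
        simp only [Sym2.mem_iff, not_or] at this
        simp [Ne.symm this.1, Ne.symm this.2]
    -- Taking the leaf edge vu out of `a` costs two units of `2 • a` at u, but F spends only one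
    -- there on vu. Deleting one more edge at u, if any, restores the bound: two edges are lost for
    -- one gained.
    obtain ⟨F'', hle, hcard, hdeg⟩ : ∃ F'' ≤ F', F'.card ≤ F''.card + 1 ∧
        (degVec F'' u = 0 ∨ degVec F'' u + 1 ≤ degVec F' u) := by
      by_cases hu : ∃ e ∈ F', u ∈ e
      · obtain ⟨e, he, hue⟩ := hu
        obtain ⟨w, rfl⟩ := Sym2.mem_iff_exists.1 hue
        obtain ⟨F'', rfl⟩ := Multiset.exists_cons_of_mem he
        refine ⟨F'', Multiset.le_cons_self _ _, by simp, .inr ?_⟩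
        simp
      · refine ⟨F', le_rfl, by simp, .inl ?_⟩
        clear * - hu
        induction F' using Multiset.induction with
        | empty => simp
        | cons e F ih =>
          push Not at hu
          rw [degVec_cons, Finsupp.add_apply, ih]
          · have := hu e (Multiset.mem_cons_self _ _)
            induction e with | _ x y =>
            simp only [Sym2.mem_iff, not_or] at this
            simp [Ne.symm this.1, Ne.symm this.2]
          · push Not
            exact fun e he ↦ hu e (Multiset.mem_cons_of_mem he)
    have hmono : degVec F'' ≤ degVec F' := by
      obtain ⟨D, rfl⟩ := Multiset.le_iff_exists_add.1 hle
      simp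
    have ha' : ∀ w, (Finsupp.single v 1 w + Finsupp.single u 1 w) + degVec F' w ≤ 2 * a w := by
      simpa using fun w ↦ ha w
    have hea : edgeVec s(v, u) ≤ a := by
      intro w
      have := ha' w
      simp only [edgeVec_mk, Finsupp.add_apply, Finsupp.single_apply] at this ⊢
      split_ifs at this ⊢ <;> first | omega | (exact absurd (by simp_all) hne)
    refine step {s(v, u)} 0 0 F'' (a - edgeVec s(v, u)) ?_ (hle.trans (Multiset.le_cons_self _ _))
      ?_ ?_ ?_ ?_
    · have := Multiset.card_le_card hle
      simp; omega
    · simpa using hF _ hvu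
    · intro w
      have h1 := ha' w
      have h2 := hea w
      have h3 : degVec F'' w ≤ degVec F' w := hmono w
      have hva := ha' v
      simp only [edgeVec_mk, Finsupp.add_apply, Finsupp.single_apply, Finsupp.smul_apply,
        Finsupp.tsub_apply, smul_eq_mul] at h1 h2 ⊢
      by_cases hwv : v = w
      · subst hwv
        omega
      · by_cases hwu : u = w
        · subst hwu
          simp only [if_neg hwv, if_true] at h1 h2 ⊢
          omega
        · simp only [if_neg hwv, if_neg hwu] at h1 h2 ⊢
          omega
    · simp only [degVec_singleton, zero_smul, add_zero]
      rw [tsub_add_cancel_of_le hea]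
    · simp; omega
  · obtain ⟨u, p, hp⟩ : ∃ (u : V) (p : G.Walk u u), p.IsCycle ∧ ∀ e ∈ p.edges, e ∈ F := by
      simp only [SimpleGraph.IsAcyclic, not_forall, not_not] at hH
      obtain ⟨u, p, hp⟩ := hH
      have hHG : H ≤ G := fun x y hxy ↦ hF _ ((hadj x y).1 hxy)
      refine ⟨u, p.mapLe hHG, hp.mapLe hHG, fun e he ↦ ?_⟩
      rw [SimpleGraph.Walk.edges_mapLe_eq_edges] at he
      have := p.edges_subset_edgeSet he
      induction e with | _ x y => exact (hadj x y).1 this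
    obtain ⟨hp, hpF⟩ := hp
    have hsub : (p.edges : Multiset (Sym2 V)) ≤ F :=
      (Multiset.le_iff_subset (Multiset.coe_nodup.2 hp.edges_nodup)).2 hpF
    obtain ⟨F', rfl⟩ := Multiset.le_iff_exists_add.1 hsub
    have hlen : (p.edges : Multiset (Sym2 V)).card = p.length := by simp
    rw [map_add, degVec_edges_closed] at ha
    obtain ⟨b, rfl, hb⟩ := exists_add_of_two_smul_add_le ha
    have h3 := hp.three_le_length
    have hlt : F'.card < ((p.edges : Multiset (Sym2 V)) + F').card := by
      rw [Multiset.card_add]; omega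
    rcases Nat.even_or_odd p.length with hev | hodd
    · obtain ⟨k, hk⟩ := hev
      obtain ⟨E, hE, hEk, hEd⟩ := exists_matching_even k p (by omega)
      refine step E 0 0 F' b hlt (Multiset.le_add_left _ _) hE hb ?_ ?_
      · simp [hEd]
      · rw [Multiset.card_add]; omega
    · rcases hcyc u p hp hodd with ⟨hl, hc⟩ | ⟨hl, hc⟩
      · refine step 0 1 0 F' b hlt (Multiset.le_add_left _ _) (by simp) hb ?_ ?_
        · simp [hc]
        · rw [Multiset.card_add]; simp; omega
      · refine step 0 0 1 F' b hlt (Multiset.le_add_left _ _) (by simp) hb ?_ ?_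
        · simp [hc]
        · rw [Multiset.card_add]; simp; omega

/-! ### Cycles as subgraphs, and monomials in powers of the edge ideal -/

open Classical in
/-- The exponent of the vertex monomial of a subgraph. -/
noncomputable def vertVec [Fintype V] (C : G.Subgraph) : V →₀ ℕ :=
  ∑ v ∈ Finset.univ.filter (fun v ↦ v ∈ C.verts), Finsupp.single v 1

open Classical in
theorem vertVec_apply [Fintype V] (C : G.Subgraph) (v : V) :
    vertVec C v = if v ∈ C.verts then 1 else 0 := by
  simp [vertVec, Finsupp.single_apply]

theorem vertexMonomial_eq (k : Type*) [Field k] [Fintype V] (C : G.Subgraph) :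
    vertexMonomial k C = MvPolynomial.monomial (vertVec C) 1 := by
  rw [vertexMonomial, vertVec, MvPolynomial.monomial_sum_one]
  rfl

theorem vertVec_sup [Fintype V] {C C' : G.Subgraph} (h : Disjoint C.verts C'.verts) :
    vertVec (C ⊔ C') = vertVec C + vertVec C' := by
  classical
  ext v
  rw [Finsupp.add_apply, vertVec_apply, vertVec_apply, vertVec_apply, SimpleGraph.Subgraph.verts_sup]
  have : v ∈ C.verts → v ∉ C'.verts := fun hv ↦ Set.disjoint_left.1 h hv
  by_cases h1 : v ∈ C.verts <;> by_cases h2 : v ∈ C'.verts <;> simp_all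

theorem listVec_support_tail [Fintype V] {u : V} {p : G.Walk u u} (hp : p.IsCycle) :
    listVec p.support.tail = vertVec p.toSubgraph := by
  classical
  ext v
  have hmem : v ∈ p.support.tail ↔ v ∈ p.support := by
    rw [← SimpleGraph.Walk.cons_tail_support p, List.mem_cons, List.tail_cons]
    refine ⟨.inr, ?_⟩
    rintro (rfl | h)
    · exact p.end_mem_tail_support hp.not_nil
    · exact h
  rw [listVec_apply, vertVec_apply, SimpleGraph.Walk.mem_verts_toSubgraph, ← hmem]
  split_ifs with h
  · exact List.count_eq_one_of_mem hp.support_nodup h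
  · exact List.count_eq_zero_of_not_mem h

theorem length_eq_degree_vertVec [Fintype V] {u : V} {p : G.Walk u u} (hp : p.IsCycle) :
    p.length = (vertVec p.toSubgraph).degree := by
  rw [← listVec_support_tail hp, degree_listVec]
  simp

theorem degree_vertVec_of_isCycleOfSize [Fintype V] {C : G.Subgraph} {n : ℕ}
    (h : IsCycleOfSize C n) : (vertVec C).degree = n := by
  obtain ⟨u, p, hp, rfl, rfl⟩ := h
  exact (length_eq_degree_vertVec hp).symm

theorem exists_edges_of_isCycleOfSize [Fintype V] {C : G.Subgraph} {n : ℕ}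
    (h : IsCycleOfSize C n) :
    ∃ F : Multiset (Sym2 V), (∀ e ∈ F, e ∈ G.edgeSet) ∧ F.card = n ∧ degVec F = 2 • vertVec C := by
  obtain ⟨u, p, hp, rfl, rfl⟩ := h
  refine ⟨p.edges, fun e he ↦ p.edges_subset_edgeSet he, by simp, ?_⟩
  rw [degVec_edges_closed, listVec_support_tail hp]

theorem exists_matching_of_isCycleOfSize [Fintype V] {C : G.Subgraph} {n : ℕ}
    (h : IsCycleOfSize C (2 * n + 1)) :
    ∃ F : Multiset (Sym2 V), (∀ e ∈ F, e ∈ G.edgeSet) ∧ F.card = n ∧ degVec F ≤ vertVec C := by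
  obtain ⟨u, p, hp, hl, rfl⟩ := h
  rw [← listVec_support_tail hp]
  exact exists_matching_odd n p hl

theorem monomial_degVec_mem (k : Type*) [Field k] {E : Multiset (Sym2 V)}
    (hE : ∀ e ∈ E, e ∈ G.edgeSet) :
    MvPolynomial.monomial (degVec E) (1 : k) ∈ edgeIdeal k G ^ E.card := by
  induction E using Multiset.induction with
  | empty => simp
  | cons e E ih =>
    rw [degVec_cons, Multiset.card_cons, pow_succ', ← one_mul (1 : k), ← MvPolynomial.monomial_mul]
    refine Ideal.mul_mem_mul ?_ (by simpa using ih fun e he ↦ hE e (Multiset.mem_cons_of_mem he))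
    have he := hE e (Multiset.mem_cons_self _ _)
    induction e with | _ u v =>
    refine Ideal.subset_span ⟨u, v, he, ?_⟩
    rw [edgeVec_mk, MvPolynomial.X, MvPolynomial.X, MvPolynomial.monomial_mul, one_mul]

theorem monomial_mem_of_le {k : Type*} [Field k] {I : Ideal (MvPolynomial V k)} {a b : V →₀ ℕ}
    (h : MvPolynomial.monomial a (1 : k) ∈ I) (hab : a ≤ b) (c : k) :
    MvPolynomial.monomial b c ∈ I := by
  have : MvPolynomial.monomial b c =
      MvPolynomial.monomial (b - a) c * MvPolynomial.monomial a (1 : k) := by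
    rw [MvPolynomial.monomial_mul, tsub_add_cancel_of_le hab, mul_one]
  rw [this]
  exact I.mul_mem_left _ h

theorem monomial_mem_edgeIdeal_pow {k : Type*} [Field k] {E : Multiset (Sym2 V)}
    (hE : ∀ e ∈ E, e ∈ G.edgeSet) {s : ℕ} (hs : s ≤ E.card) {a : V →₀ ℕ} (ha : degVec E ≤ a)
    (c : k) : MvPolynomial.monomial a c ∈ edgeIdeal k G ^ s :=
  monomial_mem_of_le (Ideal.pow_le_pow_right hs (monomial_degVec_mem k hE)) ha c

theorem isIntegralOverIdeal_of_mem {R : Type*} [CommRing R] {I : Ideal R} {f : R} (hf : f ∈ I) :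
    IsIntegralOverIdeal I f := by
  refine ⟨1, le_rfl, fun _ ↦ -f, fun i hi ↦ ?_, by simp⟩
  obtain rfl : i = 1 := by simpa using hi
  simpa using hf

/-- The element g + h is a root of (X - g)² - h², so additivity of the integral closure is not
needed. -/
theorem isIntegralOverIdeal_add {R : Type*} [CommRing R] {I : Ideal R} {g h : R} (hg : g ∈ I)
    (hh : h ^ 2 ∈ I ^ 2) : IsIntegralOverIdeal I (g + h) := by
  refine ⟨2, one_le_two, fun i ↦ if i = 1 then -2 * g else g ^ 2 - h ^ 2, fun i hi ↦ ?_, ?_⟩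
  · dsimp only
    split_ifs with hi1
    · subst hi1
      simpa using I.mul_mem_left (-2) hg
    · obtain rfl : i = 2 := by simp at hi; omega
      exact sub_mem (Ideal.pow_mem_pow hg 2) hh
  · rw [show Finset.Icc 1 2 = {1, 2} from rfl]
    simp
    ring

/-! ### The two odd cycles and the bow -/

/-- Edges that fit into `a`, together with at most one copy of each of the two odd cycles. -/
theorem exists_decomposition_le_one [Fintype V] {C₁ C₂ : G.Subgraph} {m n : ℕ}
    (hC₁ : IsCycleOfSize C₁ (2 * m + 1)) (hC₂ : IsCycleOfSize C₂ (2 * n + 1))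
    (hG : ∀ C : G.Subgraph, IsOddCycle C → C = C₁ ∨ C = C₂)
    {F : Multiset (Sym2 V)} (hF : ∀ e ∈ F, e ∈ G.edgeSet) {a : V →₀ ℕ} (ha : degVec F ≤ 2 • a) :
    ∃ (E : Multiset (Sym2 V)) (i j : ℕ), (∀ e ∈ E, e ∈ G.edgeSet) ∧ i < 2 ∧ j < 2 ∧
      degVec E + i • vertVec C₁ + j • vertVec C₂ ≤ a ∧
      F.card ≤ 2 * E.card + i * (2 * m + 1) + j * (2 * n + 1) := by
  obtain ⟨E, i, j, hE, hd, hc⟩ := exists_decomposition (c₁ := vertVec C₁) (c₂ := vertVec C₂)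
    (m := m) (n := n) (fun u p hp hodd ↦ by
      rw [length_eq_degree_vertVec hp, listVec_support_tail hp]
      rcases hG p.toSubgraph ⟨_, hodd, u, p, hp, rfl, rfl⟩ with h | h <;> rw [h]
      · exact .inl ⟨degree_vertVec_of_isCycleOfSize hC₁, rfl⟩
      · exact .inr ⟨degree_vertVec_of_isCycleOfSize hC₂, rfl⟩) F hF a ha
  obtain ⟨F₁, hF₁, hk₁, hd₁⟩ := exists_edges_of_isCycleOfSize hC₁
  obtain ⟨F₂, hF₂, hk₂, hd₂⟩ := exists_edges_of_isCycleOfSize hC₂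
  -- Two copies of an odd cycle have the exponent of its edge set, so pairs become edges and only
  -- the parities of i and j remain.
  refine ⟨E + (i / 2) • F₁ + (j / 2) • F₂, i % 2, j % 2, fun e he ↦ ?_,
    Nat.mod_lt _ two_pos, Nat.mod_lt _ two_pos, ?_, ?_⟩
  · rcases Multiset.mem_add.1 he with he | he
    · rcases Multiset.mem_add.1 he with he | he
      · exact hE e he
      · exact hF₁ e (Multiset.mem_of_mem_nsmul he)
    · exact hF₂ e (Multiset.mem_of_mem_nsmul he)
  · refine le_trans (le_of_eq ?_) hd
    simp only [map_add, map_nsmul, hd₁, hd₂, ← mul_nsmul]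
    nth_rw 3 [← Nat.div_add_mod i 2]
    nth_rw 3 [← Nat.div_add_mod j 2]
    simp only [add_smul]
    abel
  · simp only [Multiset.card_add, Multiset.card_nsmul, hk₁, hk₂]
    refine hc.trans (le_of_eq ?_)
    nth_rw 1 [← Nat.div_add_mod i 2]
    nth_rw 1 [← Nat.div_add_mod j 2]
    ring

/-- A monomial that occurs in an element integral over `I(G) ^ s` lies in `I(G) ^ s`, or it leaves
room for both odd cycles and further edges. -/
theorem monomial_mem_or_exists [Fintype V] {k : Type*} [Field k] {C₁ C₂ : G.Subgraph} {m n : ℕ}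
    (hC₁ : IsCycleOfSize C₁ (2 * m + 1)) (hC₂ : IsCycleOfSize C₂ (2 * n + 1))
    (hG : ∀ C : G.Subgraph, IsOddCycle C → C = C₁ ∨ C = C₂) {s : ℕ} {f : MvPolynomial V k}
    (hf : IsIntegralOverIdeal (edgeIdeal k G ^ s) f) {a : V →₀ ℕ} (ha : a ∈ f.support) :
    (∀ c : k, MvPolynomial.monomial a c ∈ edgeIdeal k G ^ s) ∨
    ∃ E : Multiset (Sym2 V), (∀ e ∈ E, e ∈ G.edgeSet) ∧
      vertVec C₁ + vertVec C₂ + degVec E ≤ a ∧ s ≤ E.card + (m + n + 1) := by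
  obtain ⟨F, hF, hsF, hFa⟩ := exists_edges_of_le_weight (G := G) (a := a) (N := 2 * s)
    fun w hw ↦ le_weight_of_isIntegralOverIdeal hf hw ha
  obtain ⟨E, i, j, hE, hi, hj, hd, hc⟩ := exists_decomposition_le_one hC₁ hC₂ hG hF hFa
  obtain ⟨M₁, hM₁, hk₁, hd₁⟩ := exists_matching_of_isCycleOfSize hC₁
  obtain ⟨M₂, hM₂, hk₂, hd₂⟩ := exists_matching_of_isCycleOfSize hC₂
  have key (M : Multiset (Sym2 V)) (hM : ∀ e ∈ M, e ∈ G.edgeSet)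
      (hMd : degVec M ≤ i • vertVec C₁ + j • vertVec C₂) (hs : s ≤ E.card + M.card) (c : k) :
      MvPolynomial.monomial a c ∈ edgeIdeal k G ^ s := by
    refine monomial_mem_edgeIdeal_pow (E := E + M)
      (fun e he ↦ (Multiset.mem_add.1 he).elim (hE e) (hM e)) (by simpa using hs) ?_ c
    rw [map_add]
    rw [add_assoc] at hd
    exact (add_le_add_right hMd _).trans hd
  -- With one odd cycle, 2s ≤ 2|E| + 2m + 1 forces s ≤ |E| + m, which its matching supplies
  -- (likewise for n). With both, the two odd units add up to one extra edge, which the matchings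
  -- cannot supply.
  interval_cases i <;> interval_cases j
  · exact .inl (key 0 (by simp) (by simp) (by simp; omega))
  · exact .inl (key M₂ hM₂ (by simpa using hd₂) (by omega))
  · exact .inl (key M₁ hM₁ (by simpa using hd₁) (by omega))
  · refine .inr ⟨E, hE, ?_, by omega⟩
    rw [one_smul, one_smul] at hd
    refine le_trans (le_of_eq ?_) hd
    abel

/-- Distance at least two makes the cycles of the bow disjoint, hence distinct, so they are C₁ and
C₂ in some order. -/
theorem vertVec_bow [Fintype V] {C₁ C₂ B : G.Subgraph}
    (hG : ∀ C : G.Subgraph, IsOddCycle C → C = C₁ ∨ C = C₂) (hB : IsBow B) :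
    vertVec B = vertVec C₁ + vertVec C₂ := by
  obtain ⟨C, C', hC, hC', hd, rfl⟩ := hB
  have hdisj : Disjoint C.verts C'.verts := by
    refine Set.disjoint_left.2 fun v hv hv' ↦ ?_
    have : subgraphDist C C' ≤ G.edist v v := iInf₂_le_of_le v hv (iInf₂_le v hv')
    rw [SimpleGraph.edist_self] at this
    exact absurd (hd.trans this) (by simp)
  have hne : C ≠ C' := by
    rintro rfl
    obtain ⟨_, _, u, p, -, -, rfl⟩ := hC
    exact Set.disjoint_left.1 hdisj p.start_mem_verts_toSubgraph p.start_mem_verts_toSubgraph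
  rw [vertVec_sup hdisj]
  rcases hG C hC with rfl | rfl <;> rcases hG C' hC' with rfl | rfl
  · exact absurd rfl hne
  · rfl
  · exact add_comm _ _
  · exact absurd rfl hne

theorem eq_or_eq_of_isOddBicyclic (hG : IsOddBicyclic G) {C₁ C₂ : G.Subgraph} (hC : C₁ ≠ C₂)
    (h₁ : IsOddCycle C₁) (h₂ : IsOddCycle C₂) (C : G.Subgraph) (h : IsOddCycle C) :
    C = C₁ ∨ C = C₂ := by
  obtain ⟨x, y, -, hxy⟩ := Set.encard_eq_two.1 hG
  have key : ∀ D : G.Subgraph, IsOddCycle D → D = x ∨ D = y := fun D hD ↦ by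
    have : D ∈ {C : G.Subgraph | IsOddCycle C} := hD
    rwa [hxy] at this
  have := key C h
  have := key C₁ h₁
  have := key C₂ h₂
  grind

end BowGraph

theorem mainTheorem6 {k : Type*} [Field k] {V : Type*} [Fintype V] (G : SimpleGraph V)
    (hG : BowGraph.IsOddBicyclic G)
    (C₁ C₂ : G.Subgraph) (hC : C₁ ≠ C₂) (m n : ℕ)
    (hC₁ : BowGraph.IsCycleOfSize C₁ (2 * m + 1)) (hC₂ : BowGraph.IsCycleOfSize C₂ (2 * n + 1))
    (B : G.Subgraph) (hB : ∀ B' : G.Subgraph, BowGraph.IsBow B' ↔ B' = B) (s : ℕ) :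
    (s ≤ m + n →
      BowGraph.idealIntegralClosure (BowGraph.edgeIdeal k G ^ s) =
        ((BowGraph.edgeIdeal k G ^ s : Ideal (MvPolynomial V k)) : Set (MvPolynomial V k))) ∧
    (m + n + 1 ≤ s →
      BowGraph.idealIntegralClosure (BowGraph.edgeIdeal k G ^ s) =
        ((BowGraph.edgeIdeal k G ^ s +
          Ideal.span {BowGraph.vertexMonomial k B} * BowGraph.edgeIdeal k G ^ (s - (m + n + 1)) :
            Ideal (MvPolynomial V k)) : Set (MvPolynomial V k))) := by
  open BowGraph in
  have hodd := eq_or_eq_of_isOddBicyclic hG hC ⟨_, odd_two_mul_add_one m, hC₁⟩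
    ⟨_, odd_two_mul_add_one n, hC₂⟩
  have hBv := vertVec_bow hodd ((hB B).2 rfl)
  refine ⟨fun hs ↦ Set.Subset.antisymm (fun f hf ↦ ?_) fun f hf ↦ isIntegralOverIdeal_of_mem hf,
    fun hs ↦ Set.Subset.antisymm (fun f hf ↦ ?_) fun f hf ↦ ?_⟩
  · rw [SetLike.mem_coe, f.as_sum]
    refine Ideal.sum_mem _ fun a ha ↦ ?_
    rcases monomial_mem_or_exists hC₁ hC₂ hodd hf ha with h | ⟨E, -, hd, -⟩
    · exact h _
    -- Here the matchings of the two cycles already provide m + n ≥ s edges.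
    · obtain ⟨M₁, hM₁, hk₁, hd₁⟩ := exists_matching_of_isCycleOfSize hC₁
      obtain ⟨M₂, hM₂, hk₂, hd₂⟩ := exists_matching_of_isCycleOfSize hC₂
      refine monomial_mem_edgeIdeal_pow (E := M₁ + M₂)
        (fun e he ↦ (Multiset.mem_add.1 he).elim (hM₁ e) (hM₂ e)) ?_ ?_ _
      · rwa [Multiset.card_add, hk₁, hk₂]
      · rw [map_add]
        exact (add_le_add hd₁ hd₂).trans (le_self_add.trans hd)
  · rw [SetLike.mem_coe, f.as_sum]
    refine Ideal.sum_mem _ fun a ha ↦ ?_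
    rcases monomial_mem_or_exists hC₁ hC₂ hodd hf ha with h | ⟨E, hE, hd, hsE⟩
    · exact Ideal.mem_sup_left (h _)
    · refine Ideal.mem_sup_right (monomial_mem_of_le ?_ hd _)
      rw [← hBv, ← one_mul (1 : k), ← MvPolynomial.monomial_mul, ← vertexMonomial_eq]
      exact Ideal.mul_mem_mul (Ideal.mem_span_singleton_self _)
        (monomial_mem_edgeIdeal_pow hE (by omega) le_rfl _)
  · obtain ⟨g, hg, h, hh, rfl⟩ := Submodule.mem_sup.1 hf
    obtain ⟨h, hh', rfl⟩ := Ideal.mem_span_singleton_mul.1 hh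
    refine isIntegralOverIdeal_add hg ?_
    -- The two cycles have 2(m + n + 1) edges in total, and these cover each vertex of B exactly
    -- twice.
    have hsq : vertexMonomial k B ^ 2 ∈ edgeIdeal k G ^ (2 * (m + n + 1)) := by
      obtain ⟨F₁, hF₁, hk₁, hd₁⟩ := exists_edges_of_isCycleOfSize hC₁
      obtain ⟨F₂, hF₂, hk₂, hd₂⟩ := exists_edges_of_isCycleOfSize hC₂
      rw [vertexMonomial_eq, MvPolynomial.monomial_pow, hBv, smul_add, ← hd₁, ← hd₂, ← map_add]
      refine monomial_mem_edgeIdeal_pow (fun e he ↦ (Multiset.mem_add.1 he).elim (hF₁ e) (hF₂ e))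
        ?_ le_rfl _
      rw [Multiset.card_add, hk₁, hk₂]
      omega
    rw [mul_pow, ← pow_mul, show s * 2 = 2 * (m + n + 1) + (s - (m + n + 1)) * 2 by omega, pow_add,
      pow_mul _ (s - (m + n + 1))]
    exact Ideal.mul_mem_mul hsq (Ideal.pow_mem_pow hh' 2)
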